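/- **Setting.** Let $n\ge 1$ and let $\Omega\subset\mathbb{R}^n$ be a bounded connected Lipschitz domain. Let $\mathcal{F}$ be a finite forest of rooted trees with node set $\mathcal{N}$ and edge set $\mathcal{E}$; each tree has exactly one root, and every root has exactly one neighbor. The set of roots is the disjoint union of the set $\mathcal{N}_D$ of Dirichlet roots, assumed to be non-empty, and the set $\mathcal{N}_N$ of Neumann roots. The terminal nodes $\mathcal{N}_T$ are the non-root nodes with exactly one neighbor, and $\mathcal{N}_I$ is the set of the remaining non-root nodes. Each edge is oriented away from the root of its tree; for $q^N\in\mathbb{R}^{\mathcal{E}}$ and neighbors $i,j$, $q^N_{i,j}$ is the value of $q^N$ on the edge between $i$ and $j$ if that edge is oriented from $i$ to $j$, and minus that value otherwise. Let $\mathcal{N}_i$ be the set of neighbors of $i$. The coefficients are: measurable sets $B_i\subseteq\Omega$ and measurable functions $k^T_i\ge 0$ that vanish outside $B_i$ ($i\in\mathcal{N}_T$), with $k^S_i:=\sqrt{k^T_i}$; a measurable, symmetric positive definite permeability tensor $k^D$ on $\Omega$; and conductivities $k^N_e>0$, $e\in\mathcal{E}$. Put $$L^2(\mathfrak{B}):=L^2(\Omega)\times\mathbb{R}^{\mathcal{N}\setminus\mathcal{N}_D},\qquad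 ([p^D,p^N],[w^D,w^N]):=\int_\Omega p^Dw^D\,dx+\sum_{i\in\mathcal{N}\setminus\mathcal{N}_D}p^N_iw^N_i,\qquad \|\mathfrak{p}\|_{L^2(\mathfrak{B})}^2:=(\mathfrak{p},\mathfrak{p}),$$ $$H_0(\operatorname{div},\mathfrak{B}):=H_0(\operatorname{div},\Omega)\times\prod_{i\in\mathcal{N}_T}L^2(B_i)\times\mathbb{R}^{\mathcal{E}},$$ where $H_0(\operatorname{div},\Omega)$ is the space of the fields in $L^2(\Omega)^n$ with weak divergence in $L^2(\Omega)$ and vanishing normal trace on $\partial\Omega$. For $\mathfrak{q}=[\boldsymbol{q}^D,q^S,q^N]\in H_0(\operatorname{div},\mathfrak{B})$ let $\mathfrak{D}\cdot\mathfrak{q}:=[u^D,u^N]$ be the (scaled) mixed-dimensional divergence, $$u^D:=\nabla\cdot\boldsymbol{q}^D-\sum_{i\in\mathcal{N}_T}k^S_iq^S_i,\qquad u^N_i:=\begin{cases}-\sum_{j\in\mathcal{N}_i}q^N_{j,i}, & i\in\mathcal{N}_I\cup\mathcal{N}_N,\\ \int_{B_i}k^S_iq^S_i\,dx-\sum_{j\in\mathcal{N}_i}q^N_{j,i},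 & i\in\mathcal{N}_T\end{cases}$$ (for $i\in\mathcal{N}_T$ the set $\mathcal{N}_i$ has one element), and $$\|\mathfrak{q}\|_{H(\operatorname{div},\mathfrak{B})}^2:=\int_\Omega (k^D)^{-1}\boldsymbol{q}^D\cdot\boldsymbol{q}^D\,dx+\sum_{i\in\mathcal{N}_T}\int_{B_i}|q^S_i|^2\,dx+\sum_{e\in\mathcal{E}}(k^N_e)^{-1}|q^N_e|^2+\|\mathfrak{D}\cdot\mathfrak{q}\|_{L^2(\mathfrak{B})}^2.$$ **Lemma (inf-sup condition).** Let $\Omega$ and $\mathcal{F}$ be as above, and let $b$, $C_{k^S}\in\mathbb{R}$, $N\in\mathbb{N}$, $c_{k^S}>0$, $\kappa_D>0$ and $\kappa_N>0$ be given. There is a constant $\beta>0$, depending only on $\Omega$, $\mathcal{F}$, $b$, $N$, $c_{k^S}$, $C_{k^S}$, $\kappa_D$ and $\kappa_N$, such that the following holds for all coefficients as above that satisfy - $|B_i|\le b$ for all $i\in\mathcal{N}_T$, and every point lies in at most $N$ of the sets $B_i$; - $\int_{B_i}k^S_i\,dx\ge c_{k^S}$ and $k^S_i\le C_{k^S}$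 on $\Omega$ for all $i\in\mathcal{N}_T$; - $k^D(x)\xi\cdot\xi\ge\kappa_D|\xi|^2$ for all $x\in\Omega$, $\xi\in\mathbb{R}^n$, and $k^N_e\ge\kappa_N$ for all $e\in\mathcal{E}$. For every $\mathfrak{r}\in L^2(\mathfrak{B})$, $$\sup_{0\ne\mathfrak{q}\in H_0(\operatorname{div},\mathfrak{B})}\frac{(\mathfrak{r},\mathfrak{D}\cdot\mathfrak{q})}{\|\mathfrak{q}\|_{H(\operatorname{div},\mathfrak{B})}}\ \ge\ \beta\,\|\mathfrak{r}\|_{L^2(\mathfrak{B})}.$$ In particular, $\beta$ does not depend on pointwise lower bounds of the $k^T_i$. -/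

import Mathlib

open MeasureTheory
open scoped ContDiff Matrix

noncomputable section

/-- The Euclidean space `ℝⁿ` that contains the porous domain. -/
abbrev Rn (n : ℕ) : Type := EuclideanSpace ℝ (Fin n)

/-! ### The domain and the space `H(div, Ω)` -/

/-- `Ω` is a bounded, connected, open set with Lipschitz boundary: around each boundary point, in
suitable orthonormal coordinates with last axis `e`, it is the region strictly above the graph of a
Lipschitz function `γ`. Here `inner ℝ e x` is the last coordinate of `x` and `x - inner ℝ e x • e`
is its projection on the hyperplane orthogonal to `e`, where `γ` is evaluated. -/
structure IsBoundedLipschitzDomain {n : ℕ} (Ω : Set (Rn n)) : Prop where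
  isOpen : IsOpen Ω
  isConnected : IsConnected Ω
  isBounded : Bornology.IsBounded Ω
  lipschitz_boundary : ∀ x₀ ∈ frontier Ω, ∃ (e : Rn n) (ρ : ℝ) (K : NNReal) (γ : Rn n → ℝ),
    ‖e‖ = 1 ∧ 0 < ρ ∧ LipschitzWith K γ ∧
      ∀ x ∈ Metric.ball x₀ ρ, x ∈ Ω ↔ γ (x - inner ℝ e x • e) < inner ℝ e x

/-- An element of `H(div, Ω)`: a square-integrable vector field together with its square-integrable
weak divergence (which is determined by the field up to a null set). Note that
`fderiv ℝ φ x (q x) = ∇φ(x) · q(x)`. -/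
structure HDivField {n : ℕ} (Ω : Set (Rn n)) where
  toFun : Rn n → Rn n
  div : Rn n → ℝ
  memLp : MemLp toFun 2 (volume.restrict Ω)
  div_memLp : MemLp div 2 (volume.restrict Ω)
  weak_div : ∀ φ : Rn n → ℝ, ContDiff ℝ ∞ φ → HasCompactSupport φ → tsupport φ ⊆ Ω →
    (∫ x in Ω, fderiv ℝ φ x (toFun x)) = -(∫ x in Ω, div x * φ x)

/-- The normal trace `q · n` vanishes on `∂Ω`, in the usual weak sense given by Green's formula:
`⟨q · n, φ⟩ = ∫_Ω (q · ∇φ + φ ∇ · q) = 0` for all `φ` smooth up to the boundary. -/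
def HDivField.NormalTraceZero {n : ℕ} {Ω : Set (Rn n)} (q : HDivField Ω) : Prop :=
  ∀ φ : Rn n → ℝ, ContDiff ℝ ∞ φ → HasCompactSupport φ →
    ∫ x in Ω, (fderiv ℝ φ x (q.toFun x) + q.div x * φ x) = 0

/-! ### The forest -/

/-- A finite forest of rooted trees on the node set `V`. Every tree has exactly one root, which is
either a Dirichlet root or a Neumann root, and every root has exactly one neighbor. -/
structure RootedForest (V : Type*) where
  graph : SimpleGraph V
  acyclic : graph.IsAcyclic
  dirichlet : Set V
  neumann : Set V
  disjoint : Disjoint dirichlet neumann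
  existsUnique_root : ∀ v : V, ∃! ρ : V, ρ ∈ dirichlet ∪ neumann ∧ graph.Reachable ρ v
  root_degree : ∀ ρ ∈ dirichlet ∪ neumann, (graph.neighborSet ρ).ncard = 1

namespace RootedForest

variable {V : Type*} (F : RootedForest V)

/-- The set of all roots. -/
def roots : Set V := F.dirichlet ∪ F.neumann

/-- Terminal nodes are the leaves other than the roots. -/
def IsTerminal (v : V) : Prop := v ∉ F.roots ∧ (F.graph.neighborSet v).ncard = 1

/-- The type of terminal nodes. -/
abbrev Terminal : Type _ := {v : V // F.IsTerminal v}

/-- The nodes that are not Dirichlet roots. -/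
abbrev Free : Type _ := {v : V // v ∉ F.dirichlet}

/-- The type of edges. -/
abbrev Edge : Type _ := F.graph.edgeSet

/-- The edge between the neighbors `i` and `j` is oriented from `i` to `j`, that is, away from the
root of the tree. -/
def Outward (i j : V) : Prop :=
  ∃ ρ ∈ F.roots, F.graph.Reachable ρ i ∧ F.graph.dist ρ i < F.graph.dist ρ j

open Classical in
/-- The flow `q_{i,j}` from node `i` to node `j`, for edge fluxes `q` that are counted in the
direction from the root to the terminals; so `q_{j,i} = - q_{i,j}`, and the value is zero when `i`
and `j` are not neighbors. -/
def flow (q : F.Edge → ℝ) (i j : V) : ℝ :=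
  if h : F.graph.Adj i j then
    (if F.Outward i j then q ⟨s(i, j), h⟩ else -q ⟨s(i, j), h⟩)
  else 0

end RootedForest

/-! ### The coupled model -/

/-- The coefficients of the coupled model on `Ω ⊔ F`: regions `B i ⊆ Ω` around the terminals, the
transfer coefficients `kT i ≥ 0`, supported in `B i`, the symmetric positive definite permeability
tensor `kD` of the domain, and the conductivities `kN` of the edges. -/
structure CoupledModel {n : ℕ} (Ω : Set (Rn n)) {V : Type*} (F : RootedForest V) where
  B : F.Terminal → Set (Rn n)
  measurableSet_B : ∀ i, MeasurableSet (B i)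
  B_subset : ∀ i, B i ⊆ Ω
  kT : F.Terminal → Rn n → ℝ
  measurable_kT : ∀ i, Measurable (kT i)
  kT_nonneg : ∀ i x, 0 ≤ kT i x
  kT_support : ∀ i, Function.support (kT i) ⊆ B i
  kD : Rn n → Matrix (Fin n) (Fin n) ℝ
  measurable_kD : ∀ a b, Measurable fun x => kD x a b
  kD_posDef : ∀ x ∈ Ω, (kD x).PosDef
  kN : F.Edge → ℝ
  kN_pos : ∀ e, 0 < kN e

/-- A pair `[p^D, p^N]` of a function on the domain and a function on the nodes that are not
Dirichlet roots. -/
structure MDScalar {n : ℕ} (Ω : Set (Rn n)) {V : Type*} (F : RootedForest V) where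
  D : Rn n → ℝ
  N : F.Free → ℝ

namespace MDScalar

variable {n : ℕ} {Ω : Set (Rn n)} {V : Type*} [Fintype V] {F : RootedForest V}

/-- Membership in `L²(𝔅) = L²(Ω) × l²(𝒩 ∖ 𝒩_D)`. -/
def MemL2 {V : Type*} {F : RootedForest V} (p : MDScalar Ω F) : Prop :=
  MemLp p.D 2 (volume.restrict Ω)

open Classical in
/-- The inner product of `L²(𝔅)`. -/
def inner (p w : MDScalar Ω F) : ℝ :=
  (∫ x in Ω, p.D x * w.D x) + ∑ i, p.N i * w.N i

/-- The norm of `L²(𝔅)`. -/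
def norm (p : MDScalar Ω F) : ℝ := √(p.inner p)

end MDScalar

namespace CoupledModel

variable {n : ℕ} {Ω : Set (Rn n)} {V : Type*} {F : RootedForest V}

/-- The square root `k_i^S` of the transfer coefficient. -/
def kS (M : CoupledModel Ω F) (i : F.Terminal) (x : Rn n) : ℝ := √(M.kT i x)

/-- An element `[q^D, q^S, q^N]` of `H(div, 𝔅) = H(div, Ω) × ∏ L²(B_i) × l²(ℰ)`, with scaled
transfer fluxes `q_i^S`. -/
structure Flux (M : CoupledModel Ω F) where
  qD : HDivField Ω
  qS : F.Terminal → Rn n → ℝ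
  qS_memLp : ∀ i, MemLp (qS i) 2 (volume.restrict (M.B i))
  qN : F.Edge → ℝ

namespace Flux

variable [Fintype V] {M : CoupledModel Ω F}

/-- Membership in `H₀(div, 𝔅)`: the normal trace of `q^D` vanishes on `∂Ω`. -/
def MemH0 {V : Type*} {F : RootedForest V} {M : CoupledModel Ω F} (q : M.Flux) : Prop :=
  q.qD.NormalTraceZero

open Classical in
/-- The scaled mixed-dimensional divergence `[u^D, u^N]`. Outside `B_i` the product `k_i^S q_i^S`
is zero because `k_i^S` is; and a terminal node has only one neighbor, so that at such a node the
sum over the neighbors is the single flow into it. -/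
def mixedDiv (q : M.Flux) : MDScalar Ω F where
  D x := q.qD.div x - ∑ i, M.kS i x * q.qS i x
  N i := (if h : F.IsTerminal i.1 then (∫ x in M.B ⟨i.1, h⟩, M.kS ⟨i.1, h⟩ x * q.qS ⟨i.1, h⟩ x)
      else 0) - ∑ j, F.flow q.qN j i.1

open Classical in
/-- The square of the weighted norm, with weights `(k^D)⁻¹`, `1` and `(k^N)⁻¹`. -/
def weightedNormSq (q : M.Flux) : ℝ :=
  (∫ x in Ω, (q.qD.toFun x).ofLp ⬝ᵥ ((M.kD x)⁻¹ *ᵥ (q.qD.toFun x).ofLp))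
    + (∑ i, ∫ x in M.B i, q.qS i x ^ 2)
    + ∑ e, (M.kN e)⁻¹ * q.qN e ^ 2

/-- The norm of `H(div, 𝔅)`. -/
def norm (q : M.Flux) : ℝ := √(q.weightedNormSq + q.mixedDiv.norm ^ 2)

end Flux

end CoupledModel

end

/-! ### Poincaré inequalities -/

/-! The inf-sup condition follows from a right inverse of the mixed-dimensional divergence, bounded
uniformly in the coefficients: if `q.mixedDiv = r` and `q.norm ≤ β⁻¹ * r.norm`, then `q` alone makes
the quotient at least `β * r.norm`.

To build `q`, the network is treated first. Every tree has a terminal and at least one root is a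
Dirichlet root, whose balance is not prescribed. Hence any node data can be matched by edge fluxes
and terminal transfers `a i`, while the total transfer is still free
(`RootedForest.exists_bounded_flow`). It is set to `-∫ r.D`. The transfer flux on `B i` is the
constant `a i / ∫ kS i`, so only the integral of `kS i` has to be bounded below.

The divergence still required of `q^D` is then `r.D` plus the transfer term; its mean vanishes, so a
field with zero normal trace exists (`HasPoincare.exists_hDivField`). This is dual to the Poincaré
inequality on `Ω`, which is proved by integrating along segments near each point of the closure and
chaining the local inequalities by connectedness (`IsBoundedLipschitzDomain.hasPoincare`). -/

lemma enorm_sub_sq_le_mul_lintegral {n : ℕ} {φ : Rn n → ℝ} (hφ : ContDiff ℝ 1 φ) (x y : Rn n) :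
    ‖φ y - φ x‖ₑ ^ 2 ≤
      ‖y - x‖ₑ ^ 2 * ∫⁻ t in Set.Icc (0 : ℝ) 1, ‖fderiv ℝ φ (x + t • (y - x))‖ₑ ^ 2 := by
  have hcont : Continuous fun t : ℝ => fderiv ℝ φ (x + t • (y - x)) :=
    (hφ.continuous_fderiv one_ne_zero).comp (by fun_prop)
  have hu : Continuous fun t : ℝ => fderiv ℝ φ (x + t • (y - x)) (y - x) :=
    hcont.clm_apply continuous_const
  have hderiv : ∀ t : ℝ, HasDerivAt (fun s : ℝ => φ (x + s • (y - x)))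
      (fderiv ℝ φ (x + t • (y - x)) (y - x)) t := by
    intro t
    have h1 : HasDerivAt (fun s : ℝ => x + s • (y - x)) (y - x) t := by
      simpa using ((hasDerivAt_id t).smul_const (y - x)).const_add x
    exact ((hφ.differentiable one_ne_zero _).hasFDerivAt).comp_hasDerivAt t h1
  have hftc := intervalIntegral.integral_eq_sub_of_hasDerivAt (a := 0) (b := 1)
    (fun t _ => hderiv t) (hu.intervalIntegrable 0 1)
  simp only [one_smul, add_sub_cancel, zero_smul, add_zero] at hftc
  rw [← hftc, intervalIntegral.integral_of_le zero_le_one, ← integral_Icc_eq_integral_Ioc]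
  -- On a probability space the L¹ norm is at most the L² norm, which squares the fundamental
  -- theorem of calculus without a constant.
  have : IsProbabilityMeasure (volume.restrict (Set.Icc (0 : ℝ) 1)) := ⟨by simp⟩
  have h1 := eLpNorm_le_eLpNorm_of_exponent_le (p := 1) (q := 2)
    (μ := volume.restrict (Set.Icc (0 : ℝ) 1)) one_le_two hu.aestronglyMeasurable
  calc _ ≤ (eLpNorm (fun t : ℝ => fderiv ℝ φ (x + t • (y - x)) (y - x)) 2
          (volume.restrict (Set.Icc (0 : ℝ) 1))) ^ 2 := by
        gcongr
        refine (enorm_integral_le_lintegral_enorm _).trans ?_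
        rwa [eLpNorm_one_eq_lintegral_enorm] at h1
    _ = ∫⁻ t in Set.Icc (0 : ℝ) 1, ‖fderiv ℝ φ (x + t • (y - x)) (y - x)‖ₑ ^ 2 := by
        have := eLpNorm_nnreal_pow_eq_lintegral (p := 2) (μ := volume.restrict (Set.Icc (0 : ℝ) 1))
          (f := fun t : ℝ => fderiv ℝ φ (x + t • (y - x)) (y - x)) two_ne_zero
        simpa using this
    _ ≤ ∫⁻ t in Set.Icc (0 : ℝ) 1, ‖y - x‖ₑ ^ 2 * ‖fderiv ℝ φ (x + t • (y - x))‖ₑ ^ 2 := by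
        refine lintegral_mono fun t => ?_
        rw [← mul_pow, mul_comm]
        gcongr
        exact ContinuousLinearMap.le_opENorm _ _
    _ = _ := by
        rw [lintegral_const_mul]
        exact hcont.enorm.measurable.pow_const 2

lemma lintegral_comp_add_smul_le {n : ℕ} {G : Rn n → ENNReal} (hG : Measurable G) {t : ℝ}
    (ht : 1 / 2 ≤ t) (c : Rn n) : ∫⁻ y, G (c + t • y) ≤ 2 ^ n * ∫⁻ z, G z := by
  have ht0 : 0 < t := by linarith
  have h1 : ∫⁻ y, G (c + t • y) = ∫⁻ z, G (c + z) ∂(volume.map (t • · : Rn n → Rn n)) := by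
    rw [lintegral_map (f := fun z => G (c + z)) (hG.comp (measurable_const_add c))
      (measurable_const_smul t)]
  rw [h1, Measure.map_addHaar_smul volume ht0.ne', lintegral_smul_measure, smul_eq_mul,
    lintegral_add_left_eq_self G c]
  gcongr
  rw [finrank_euclideanSpace_fin, abs_of_pos (by positivity), ← inv_pow]
  calc ENNReal.ofReal (t⁻¹ ^ n) ≤ ENNReal.ofReal (2 ^ n) := by
        apply ENNReal.ofReal_le_ofReal
        gcongr
        rw [inv_le_comm₀ ht0 two_pos]
        linarith
    _ = 2 ^ n := by rw [ENNReal.ofReal_pow two_pos.le]; simp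

/-- One of the weights `t` and `1 - t` is at least `1 / 2`. Integrating first over the endpoint with
that weight is a change of variables with Jacobian factor at most `2 ^ n`, uniformly in `t`; the
other endpoint contributes the volume of its set. -/
lemma lintegral_lintegral_comp_segment_le {n : ℕ} {A B : Set (Rn n)} {G : Rn n → ENNReal}
    (hG : Measurable G) {t : ℝ} :
    ∫⁻ y in B, ∫⁻ x in A, G (x + t • (y - x)) ≤
      2 ^ n * (volume A + volume B) * ∫⁻ z, G z := by
  have hmeas : Measurable fun p : Rn n × Rn n => G (p.2 + t • (p.1 - p.2)) :=
    hG.comp (by fun_prop)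
  rcases le_total t (1 / 2) with ht | ht
  · calc ∫⁻ y in B, ∫⁻ x in A, G (x + t • (y - x)) ≤ ∫⁻ y in B, 2 ^ n * ∫⁻ z, G z := by
          refine lintegral_mono fun y => (setLIntegral_le_lintegral _ _).trans ?_
          refine le_trans (le_of_eq ?_)
            (lintegral_comp_add_smul_le hG (t := 1 - t) (by linarith) (t • y))
          congr 1 with x
          congr 1
          module
      _ ≤ _ := by
          rw [setLIntegral_const, mul_right_comm]
          gcongr
          exact le_add_self
  · rw [lintegral_lintegral_swap hmeas.aemeasurable]
    calc ∫⁻ x in A, ∫⁻ y in B, G (x + t • (y - x)) ≤ ∫⁻ x in A, 2 ^ n * ∫⁻ z, G z := by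
          refine lintegral_mono fun x => (setLIntegral_le_lintegral _ _).trans ?_
          refine le_trans (le_of_eq ?_)
            (lintegral_comp_add_smul_le hG ht ((1 - t) • x))
          congr 1 with y
          congr 1
          module
      _ ≤ _ := by
          rw [setLIntegral_const, mul_right_comm]
          gcongr
          exact le_self_add

/-- If all segments joining `A` to `B` stay in `Ω`, then the mean square difference between values
of `φ` on `A` and on `B` is controlled by the gradient of `φ` on `Ω`. -/
lemma lintegral_lintegral_enorm_sub_sq_le {n : ℕ} {Ω A B : Set (Rn n)} (hΩ : MeasurableSet Ω)
    (hA : MeasurableSet A) (hB : MeasurableSet B)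
    (hseg : ∀ x ∈ A, ∀ y ∈ B, segment ℝ x y ⊆ Ω) {d : ENNReal}
    (hd : ∀ x ∈ A, ∀ y ∈ B, ‖y - x‖ₑ ≤ d) {φ : Rn n → ℝ} (hφ : ContDiff ℝ 1 φ) :
    ∫⁻ y in B, ∫⁻ x in A, ‖φ x - φ y‖ₑ ^ 2 ≤
      d ^ 2 * (2 ^ n * (volume A + volume B)) * ∫⁻ x in Ω, ‖fderiv ℝ φ x‖ₑ ^ 2 := by
  -- Cutting the gradient off outside `Ω` changes nothing on the segments, and turns the whole-space
  -- integral after the change of variables into one over `Ω`.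
  set G : Rn n → ENNReal := Ω.indicator fun z => ‖fderiv ℝ φ z‖ₑ ^ 2 with hGdef
  have hG : Measurable G :=
    ((hφ.continuous_fderiv one_ne_zero).enorm.measurable.pow_const 2).indicator hΩ
  have hmeas : Measurable fun p : (Rn n × ℝ) × Rn n => G (p.2 + p.1.2 • (p.1.1 - p.2)) :=
    hG.comp (by fun_prop)
  have hpoint : ∀ x ∈ A, ∀ y ∈ B, ‖φ x - φ y‖ₑ ^ 2 ≤
      d ^ 2 * ∫⁻ t in Set.Icc (0 : ℝ) 1, G (x + t • (y - x)) := by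
    intro x hx y hy
    rw [← enorm_neg, neg_sub]
    refine (enorm_sub_sq_le_mul_lintegral hφ x y).trans ?_
    refine mul_le_mul' (pow_le_pow_left' (hd x hx y hy) 2) ?_
    refine setLIntegral_mono_ae' measurableSet_Icc (Filter.Eventually.of_forall fun t ht => ?_)
    rw [hGdef, Set.indicator_of_mem]
    exact hseg x hx y hy (segment_eq_image' ℝ x y ▸ ⟨t, ht, rfl⟩)
  calc ∫⁻ y in B, ∫⁻ x in A, ‖φ x - φ y‖ₑ ^ 2
      ≤ ∫⁻ y in B, ∫⁻ x in A, d ^ 2 * ∫⁻ t in Set.Icc (0 : ℝ) 1, G (x + t • (y - x)) := by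
        refine setLIntegral_mono_ae' hB (Filter.Eventually.of_forall fun y hy => ?_)
        exact setLIntegral_mono_ae' hA (Filter.Eventually.of_forall fun x hx => hpoint x hx y hy)
    _ = d ^ 2 * ∫⁻ y in B, ∫⁻ x in A, ∫⁻ t in Set.Icc (0 : ℝ) 1, G (x + t • (y - x)) := by
        have h3 : Measurable fun p : (Rn n × Rn n) × ℝ => G (p.1.2 + p.2 • (p.1.1 - p.1.2)) :=
          hG.comp (by fun_prop)
        have h4 := h3.lintegral_prod_right' (ν := volume.restrict (Set.Icc (0 : ℝ) 1))
        rw [← lintegral_const_mul _ (h4.lintegral_prod_right' (ν := volume.restrict A))]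
        congr 1 with y
        rw [lintegral_const_mul]
        exact h4.comp (measurable_const.prodMk measurable_id)
    _ = d ^ 2 * ∫⁻ t in Set.Icc (0 : ℝ) 1, ∫⁻ y in B, ∫⁻ x in A, G (x + t • (y - x)) := by
        congr 1
        have h5 : AEMeasurable (Function.uncurry fun (y : Rn n) (t : ℝ) =>
            ∫⁻ x in A, G (x + t • (y - x)))
            ((volume.restrict B).prod (volume.restrict (Set.Icc (0 : ℝ) 1))) :=
          (hmeas.lintegral_prod_right' (ν := volume.restrict A)).aemeasurable
        rw [← lintegral_lintegral_swap h5]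
        congr 1 with y
        have h6 : Measurable (Function.uncurry fun (x : Rn n) (t : ℝ) => G (x + t • (y - x))) :=
          hG.comp (by fun_prop)
        exact lintegral_lintegral_swap h6.aemeasurable
    _ ≤ d ^ 2 * ∫⁻ t in Set.Icc (0 : ℝ) 1, 2 ^ n * (volume A + volume B) * ∫⁻ z, G z := by
        gcongr
        exact lintegral_lintegral_comp_segment_le hG
    _ = _ := by
        rw [setLIntegral_const, hGdef, lintegral_indicator hΩ]
        simp [mul_assoc]

/-- The Poincaré inequality on `A`, with the gradient measured on `Ω`. -/
def HasPoincare {n : ℕ} (Ω A : Set (Rn n)) : Prop :=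
  ∃ C : ENNReal, C ≠ ⊤ ∧ ∀ φ : Rn n → ℝ, ContDiff ℝ 1 φ →
    ∃ m : ℝ, ∫⁻ x in A, ‖φ x - m‖ₑ ^ 2 ≤ C * ∫⁻ x in Ω, ‖fderiv ℝ φ x‖ₑ ^ 2

lemma hasPoincare_of_segment_subset {n : ℕ} {Ω A B : Set (Rn n)} (hΩ : MeasurableSet Ω)
    (hA : MeasurableSet A) (hB : MeasurableSet B) (hA' : Bornology.IsBounded A)
    (hB' : Bornology.IsBounded B) (hB0 : volume B ≠ 0)
    (hseg : ∀ x ∈ A, ∀ y ∈ B, segment ℝ x y ⊆ Ω) : HasPoincare Ω A := by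
  obtain ⟨R, hR⟩ := (hA'.union hB').exists_norm_le
  have hAv : volume A ≠ ⊤ := hA'.measure_lt_top.ne
  have hBv : volume B ≠ ⊤ := hB'.measure_lt_top.ne
  have hd : ∀ x ∈ A, ∀ y ∈ B, ‖y - x‖ₑ ≤ ENNReal.ofReal (R + R) := by
    intro x hx y hy
    rw [← ofReal_norm]
    exact ENNReal.ofReal_le_ofReal
      ((norm_sub_le _ _).trans (add_le_add (hR y (Or.inr hy)) (hR x (Or.inl hx))))
  refine ⟨(volume B)⁻¹ * (ENNReal.ofReal (R + R) ^ 2 * (2 ^ n * (volume A + volume B))), ?_, ?_⟩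
  · refine ENNReal.mul_ne_top (ENNReal.inv_ne_top.2 hB0) (ENNReal.mul_ne_top (by simp) ?_)
    exact ENNReal.mul_ne_top (by simp) (by simp [hAv, hBv])
  · intro φ hφ
    have hmeas : Measurable fun p : Rn n × Rn n => ‖φ p.2 - φ p.1‖ₑ ^ 2 := by
      have := hφ.continuous
      exact Measurable.pow_const (by fun_prop) 2
    -- The constant `m` is the value of `φ` at a point `y` where the integral over `A` does not
    -- exceed its average over `B`.
    obtain ⟨y, -, hy⟩ := exists_le_setLAverage hB0 hBv
      ((hmeas.lintegral_prod_right' (ν := volume.restrict A)).aemeasurable)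
    refine ⟨φ y, hy.trans ?_⟩
    rw [setLAverage_eq, ENNReal.div_eq_inv_mul, mul_assoc]
    gcongr
    exact lintegral_lintegral_enorm_sub_sq_le hΩ hA hB hseg hd hφ

lemma enorm_sub_sq_le_two_mul (u v w : ℝ) :
    ‖u - w‖ₑ ^ 2 ≤ 2 * (‖u - v‖ₑ ^ 2 + ‖v - w‖ₑ ^ 2) := by
  have hsq : ∀ a : ℝ, ‖a‖ₑ ^ 2 = ENNReal.ofReal (a ^ 2) := fun a => by
    rw [← ofReal_norm, ← ENNReal.ofReal_pow (norm_nonneg _), Real.norm_eq_abs, sq_abs]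
  rw [hsq, hsq, hsq]
  rw [← ENNReal.ofReal_add (by positivity) (by positivity), ← ENNReal.ofReal_ofNat 2,
    ← ENNReal.ofReal_mul (by positivity)]
  apply ENNReal.ofReal_le_ofReal
  nlinarith [sq_nonneg ((u - v) - (v - w))]

/-- On the overlap `φ` is close to both constants `m` and `m'`, so these are close to each other,
and `m` can replace `m'` on `A'`. -/
lemma HasPoincare.union {n : ℕ} {Ω A A' : Set (Rn n)} (hA : HasPoincare Ω A)
    (hA' : HasPoincare Ω A') (hfin : volume A' ≠ ⊤)
    (hinter : volume (A ∩ A') ≠ 0) : HasPoincare Ω (A ∪ A') := by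
  obtain ⟨C, hC, h⟩ := hA
  obtain ⟨C', hC', h'⟩ := hA'
  have hI : volume (A ∩ A') ≠ ⊤ := ne_top_of_le_ne_top hfin (measure_mono Set.inter_subset_right)
  refine ⟨C + 2 * (C' + (volume (A ∩ A'))⁻¹ * (2 * (C + C')) * volume A'), ?_, ?_⟩
  · have := ENNReal.inv_ne_top.2 hinter
    finiteness
  intro φ hφ
  obtain ⟨m, hm⟩ := h φ hφ
  obtain ⟨m', hm'⟩ := h' φ hφ
  refine ⟨m, ?_⟩
  have hmeas : ∀ c : ℝ, Measurable fun x => ‖φ x - c‖ₑ ^ 2 := fun c =>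
    (hφ.continuous.sub continuous_const).enorm.measurable.pow_const 2
  set D := ∫⁻ x in Ω, ‖fderiv ℝ φ x‖ₑ ^ 2
  have hmm : ‖m' - m‖ₑ ^ 2 ≤ (volume (A ∩ A'))⁻¹ * (2 * (C + C')) * D := by
    rw [mul_assoc, ← ENNReal.div_eq_inv_mul, ENNReal.le_div_iff_mul_le (Or.inl hinter) (Or.inl hI),
      ← setLIntegral_const]
    calc ∫⁻ _ in A ∩ A', ‖m' - m‖ₑ ^ 2
        ≤ ∫⁻ x in A ∩ A', 2 * (‖φ x - m‖ₑ ^ 2 + ‖φ x - m'‖ₑ ^ 2) := by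
          refine lintegral_mono fun x => ?_
          refine (enorm_sub_sq_le_two_mul m' (φ x) m).trans (le_of_eq ?_)
          rw [add_comm, ← enorm_neg (m' - φ x), neg_sub]
      _ = 2 * ((∫⁻ x in A ∩ A', ‖φ x - m‖ₑ ^ 2) + ∫⁻ x in A ∩ A', ‖φ x - m'‖ₑ ^ 2) := by
          rw [lintegral_const_mul _ (by fun_prop), lintegral_add_left (hmeas m)]
      _ ≤ 2 * (C * D + C' * D) := by
          gcongr
          · exact (lintegral_mono_set Set.inter_subset_left).trans hm
          · exact (lintegral_mono_set Set.inter_subset_right).trans hm'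
      _ = 2 * (C + C') * D := by ring
  calc ∫⁻ x in A ∪ A', ‖φ x - m‖ₑ ^ 2
      ≤ (∫⁻ x in A, ‖φ x - m‖ₑ ^ 2) + ∫⁻ x in A', ‖φ x - m‖ₑ ^ 2 := lintegral_union_le _ _ _
    _ ≤ C * D + ∫⁻ x in A', 2 * (‖φ x - m'‖ₑ ^ 2 + ‖m' - m‖ₑ ^ 2) := by
        gcongr with x
        exact enorm_sub_sq_le_two_mul _ _ _
    _ = C * D + 2 * ((∫⁻ x in A', ‖φ x - m'‖ₑ ^ 2) + ‖m' - m‖ₑ ^ 2 * volume A') := by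
        rw [lintegral_const_mul _ (by fun_prop), lintegral_add_left (hmeas m'),
          setLIntegral_const]
    _ ≤ C * D + 2 * (C' * D + (volume (A ∩ A'))⁻¹ * (2 * (C + C')) * D * volume A') := by
        gcongr
    _ = _ := by ring

lemma HasPoincare.of_finite_cover {n : ℕ} {Ω : Set (Rn n)} (hΩ : IsOpen Ω) (hconn : IsConnected Ω)
    (hfin : volume Ω ≠ ⊤) {ι : Type*} (s : Finset ι) (U : ι → Set (Rn n))
    (hU : ∀ i, IsOpen (U i)) (hP : ∀ i ∈ s, HasPoincare Ω (Ω ∩ U i)) (hcov : Ω ⊆ ⋃ i ∈ s, U i) :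
    HasPoincare Ω Ω := by
  classical
  obtain ⟨x₀, hx₀⟩ := hconn.nonempty
  obtain ⟨i₀, hi₀, hxi₀⟩ := Set.mem_iUnion₂.1 (hcov hx₀)
  -- Among the subfamilies that contain `i₀` and whose union satisfies the inequality, take a
  -- largest one. If it missed part of `Ω`, connectedness would give a further set meeting its union
  -- inside `Ω`, and that set could be added.
  obtain ⟨t, ht, hmax⟩ := Finset.exists_max_image
    (s.powerset.filter fun t => i₀ ∈ t ∧ HasPoincare Ω (Ω ∩ ⋃ i ∈ t, U i)) Finset.card
    ⟨{i₀}, by simpa [hi₀] using hP i₀ hi₀⟩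
  simp only [Finset.mem_filter, Finset.mem_powerset] at ht hmax
  obtain ⟨hts, hit, hPt⟩ := ht
  by_cases hall : Ω ⊆ ⋃ i ∈ t, U i
  · rwa [Set.inter_eq_left.2 hall] at hPt
  exfalso
  obtain ⟨x, hx, hxt⟩ := Set.not_subset.1 hall
  obtain ⟨y, hyΩ, hyt, hyn⟩ := hconn.isPreconnected (⋃ i ∈ t, U i) (⋃ i ∈ s \ t, U i)
    (isOpen_biUnion fun i _ => hU i) (isOpen_biUnion fun i _ => hU i)
    (fun z hz => by
      obtain ⟨i, hi, hzi⟩ := Set.mem_iUnion₂.1 (hcov hz)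
      by_cases h : i ∈ t
      · exact Or.inl (Set.mem_iUnion₂.2 ⟨i, h, hzi⟩)
      · exact Or.inr (Set.mem_iUnion₂.2 ⟨i, Finset.mem_sdiff.2 ⟨hi, h⟩, hzi⟩))
    ⟨x₀, hx₀, Set.mem_iUnion₂.2 ⟨i₀, hit, hxi₀⟩⟩
    (by
      obtain ⟨i, hi, hxi⟩ := Set.mem_iUnion₂.1 (hcov hx)
      refine ⟨x, hx, Set.mem_iUnion₂.2 ⟨i, Finset.mem_sdiff.2 ⟨hi, fun h => hxt ?_⟩, hxi⟩⟩
      exact Set.mem_iUnion₂.2 ⟨i, h, hxi⟩)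
  obtain ⟨k, hk, hyk⟩ := Set.mem_iUnion₂.1 hyn
  obtain ⟨hks, hkt⟩ := Finset.mem_sdiff.1 hk
  have hopen : IsOpen ((Ω ∩ ⋃ i ∈ t, U i) ∩ (Ω ∩ U k)) :=
    (hΩ.inter (isOpen_biUnion fun i _ => hU i)).inter (hΩ.inter (hU k))
  have hnew := hPt.union (hP k hks) (ne_top_of_le_ne_top hfin (measure_mono Set.inter_subset_left))
    (hopen.measure_pos volume ⟨y, ⟨hyΩ, hyt⟩, hyΩ, hyk⟩).ne'
  have hcard := hmax (insert k t) ⟨Finset.insert_subset hks hts, Finset.mem_insert_of_mem hit, by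
    rwa [Finset.set_biUnion_insert, Set.union_comm, Set.inter_union_distrib_left]⟩
  rw [Finset.card_insert_of_notMem hkt] at hcard
  omega

lemma norm_sub_inner_smul_le {n : ℕ} {e : Rn n} (he : ‖e‖ = 1) (w : Rn n) :
    ‖w - inner ℝ e w • e‖ ≤ ‖w‖ := by
  refine le_of_sq_le_sq ?_ (norm_nonneg _)
  rw [norm_sub_sq_real, norm_smul, he, inner_smul_right, real_inner_comm, mul_one,
    Real.norm_eq_abs, sq_abs]
  nlinarith [sq_nonneg (inner ℝ e w)]

/-- At a boundary point, `B` is a ball shifted along the axis `e`, far enough that segments from `Ω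
∩ ball x₀ δ` to it climb faster than the graph. At parameter `t` the rise is at least `t * (h - 2 *
δ) = t * (2 * K * δ)`. The lateral displacement is at most `t * (2 * δ)`, so `γ` grows by no more
than that rise. -/
lemma IsBoundedLipschitzDomain.exists_ball_hasPoincare {n : ℕ} {Ω : Set (Rn n)}
    (hΩ : IsBoundedLipschitzDomain Ω) {x₀ : Rn n} (hx₀ : x₀ ∈ closure Ω) :
    ∃ δ > 0, HasPoincare Ω (Ω ∩ Metric.ball x₀ δ) := by
  by_cases hmem : x₀ ∈ Ω
  · obtain ⟨δ, hδ, hsub⟩ := Metric.isOpen_iff.1 hΩ.isOpen x₀ hmem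
    refine ⟨δ, hδ, ?_⟩
    rw [Set.inter_eq_right.2 hsub]
    exact hasPoincare_of_segment_subset hΩ.isOpen.measurableSet measurableSet_ball
      measurableSet_ball Metric.isBounded_ball Metric.isBounded_ball
      (Metric.measure_ball_pos _ _ hδ).ne'
      fun x hx y hy => ((convex_ball x₀ δ).segment_subset hx hy).trans hsub
  obtain ⟨e, ρ, K, γ, he, hρ, hγ, hgraph⟩ := hΩ.lipschitz_boundary x₀
    (by rw [hΩ.isOpen.frontier_eq]; exact ⟨hx₀, hmem⟩)
  -- The shifted ball must stay in the chart: `h + δ = (2 * K + 3) * δ ≤ ρ`.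
  set δ : ℝ := ρ / (2 * K + 4) with hδdef
  have hK : (0 : ℝ) ≤ K := K.2
  have hδ : 0 < δ := by positivity
  have hδρ : (2 * K + 4) * δ = ρ := by rw [hδdef]; field_simp
  set h : ℝ := 2 * (K + 1) * δ with hh
  have hhpos : 0 ≤ h := by positivity
  refine ⟨δ, hδ, hasPoincare_of_segment_subset (B := Metric.ball (x₀ + h • e) δ)
    hΩ.isOpen.measurableSet (hΩ.isOpen.measurableSet.inter measurableSet_ball) measurableSet_ball
    (Metric.isBounded_ball.subset Set.inter_subset_right) Metric.isBounded_ball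
    (Metric.measure_ball_pos _ _ hδ).ne' ?_⟩
  rintro x ⟨hxΩ, hx⟩ y hy
  have hKδ : 0 ≤ K * δ := by positivity
  have hxρ : x ∈ Metric.ball x₀ ρ := Metric.ball_subset_ball (by nlinarith) hx
  have hyρ : y ∈ Metric.ball x₀ ρ := by
    refine Metric.ball_subset_ball' ?_ hy
    rw [dist_self_add_left, norm_smul, he, Real.norm_eq_abs, abs_of_nonneg hhpos]
    nlinarith
  rw [segment_eq_image']
  rintro _ ⟨t, ht, rfl⟩
  have hz : x + t • (y - x) ∈ Metric.ball x₀ ρ :=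
    (convex_ball x₀ ρ).segment_subset hxρ hyρ (segment_eq_image' ℝ x y ▸ ⟨t, ht, rfl⟩)
  refine (hgraph _ hz).2 ?_
  have hxg := (hgraph x hxρ).1 hxΩ
  rw [Metric.mem_ball, dist_eq_norm] at hx hy
  set w : Rn n := y - x - h • e with hw
  have hwn : ‖w‖ ≤ 2 * δ := by
    have : w = (y - (x₀ + h • e)) - (x - x₀) := by rw [hw]; module
    rw [this]
    exact (norm_sub_le _ _).trans (by linarith)
  have hee : inner ℝ e e = (1 : ℝ) := by rw [real_inner_self_eq_norm_sq, he]; norm_num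
  have hyx : y - x = w + h • e := by rw [hw]; module
  have hwe : -(2 * δ) ≤ inner ℝ e w := by
    have := (abs_real_inner_le_norm e w).trans_eq (by rw [he, one_mul])
    exact (abs_le.1 (this.trans hwn)).1
  have hproj : x + t • (y - x) - inner ℝ e (x + t • (y - x)) • e
      = (x - inner ℝ e x • e) + t • (w - inner ℝ e w • e) := by
    rw [hyx]
    simp only [inner_add_right, inner_smul_right, hee]
    module
  have hlip := hγ.dist_le_mul ((x - inner ℝ e x • e) + t • (w - inner ℝ e w • e))
    (x - inner ℝ e x • e)
  rw [dist_self_add_left, norm_smul, Real.norm_eq_abs, abs_of_nonneg ht.1, Real.dist_eq] at hlip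
  have hlip' := (le_abs_self _).trans hlip
  have hpn : K * (t * ‖w - inner ℝ e w • e‖) ≤ t * (2 * K * δ) := by
    have := (norm_sub_inner_smul_le he w).trans hwn
    nlinarith [mul_le_mul_of_nonneg_left this (mul_nonneg hK ht.1)]
  have hval : inner ℝ e (x + t • (y - x)) = inner ℝ e x + t * (inner ℝ e w + h) := by
    rw [hyx]
    simp only [inner_add_right, inner_smul_right, hee]
    ring
  have hlow : t * (2 * K * δ) ≤ t * (inner ℝ e w + h) :=
    mul_le_mul_of_nonneg_left (by rw [hh]; linarith) ht.1
  rw [hproj, hval]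
  linarith

lemma IsBoundedLipschitzDomain.hasPoincare {n : ℕ} {Ω : Set (Rn n)}
    (hΩ : IsBoundedLipschitzDomain Ω) : HasPoincare Ω Ω := by
  choose! δ hδ hP using fun x (hx : x ∈ closure Ω) => hΩ.exists_ball_hasPoincare hx
  obtain ⟨s, hs, hcov⟩ := hΩ.isBounded.isCompact_closure.elim_nhds_subcover
    (fun x => Metric.ball x (δ x)) fun x hx => Metric.ball_mem_nhds x (hδ x hx)
  exact HasPoincare.of_finite_cover hΩ.isOpen hΩ.isConnected hΩ.isBounded.measure_lt_top.ne s
    (fun x => Metric.ball x (δ x)) (fun x => Metric.isOpen_ball) (fun x hx => hP x (hs x hx))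
    (subset_closure.trans hcov)

/-! ### A bounded right inverse of the divergence -/

/-- The bound forces `l` to vanish on the kernel of `T`, so `l` factors through the range of `T` as
a functional of norm at most `K`. Hahn–Banach extends it to `H`, and Riesz represents it. -/
lemma exists_inner_eq_of_abs_le {E H : Type*} [AddCommGroup E] [Module ℝ E]
    [NormedAddCommGroup H] [InnerProductSpace ℝ H] [CompleteSpace H] (T : E →ₗ[ℝ] H)
    (l : E →ₗ[ℝ] ℝ) {K : ℝ} (hK : 0 ≤ K) (h : ∀ v, |l v| ≤ K * ‖T v‖) :
    ∃ q : H, ‖q‖ ≤ K ∧ ∀ v, inner ℝ q (T v) = l v := by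
  have hl : l ∈ LinearMap.range T.dualMap := by
    rw [LinearMap.range_dualMap_eq_dualAnnihilator_ker, Submodule.mem_dualAnnihilator]
    intro v hv
    have := h v
    rw [LinearMap.mem_ker.1 hv, norm_zero, mul_zero] at this
    exact abs_nonpos_iff.1 this
  obtain ⟨g, hg⟩ := hl
  have hgT : ∀ v, g (T v) = l v := fun v => by rw [← hg]; rfl
  let g' : StrongDual ℝ (LinearMap.range T) :=
    (g.comp (LinearMap.range T).subtype).mkContinuous K (by
      rintro ⟨_, v, rfl⟩
      simpa [hgT] using h v)
  obtain ⟨G, hG, hGn⟩ := exists_extension_norm_eq (LinearMap.range T) g'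
  refine ⟨(InnerProductSpace.toDual ℝ H).symm G, ?_, fun v => ?_⟩
  · rw [LinearIsometryEquiv.norm_map, hGn]
    exact LinearMap.mkContinuous_norm_le _ hK _
  · rw [InnerProductSpace.toDual_symm_apply, ← hgT]
    exact hG ⟨T v, v, rfl⟩

lemma norm_toLp_sq_eq_integral {α E : Type*} [MeasurableSpace α] {μ : Measure α}
    [NormedAddCommGroup E] [InnerProductSpace ℝ E] {f : α → E} (hf : MemLp f 2 μ) :
    ‖hf.toLp f‖ ^ 2 = ∫ x, ‖f x‖ ^ 2 ∂μ := by
  rw [← real_inner_self_eq_norm_sq, L2.inner_def]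
  refine integral_congr_ae (hf.coeFn_toLp.mono fun x hx => ?_)
  simp only [hx, real_inner_self_eq_norm_sq]

lemma norm_toLp_sq_eq_toReal_lintegral {α E : Type*} [MeasurableSpace α] {μ : Measure α}
    [NormedAddCommGroup E] {f : α → E} (hf : MemLp f 2 μ) :
    ‖hf.toLp f‖ ^ 2 = (∫⁻ x, ‖f x‖ₑ ^ 2 ∂μ).toReal := by
  rw [Lp.norm_toLp, ← ENNReal.toReal_pow]
  have := eLpNorm_nnreal_pow_eq_lintegral (p := 2) (μ := μ) (f := f) two_ne_zero
  congr 1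
  simpa using this

lemma lintegral_enorm_sq_ne_top {α E : Type*} [MeasurableSpace α] {μ : Measure α}
    [NormedAddCommGroup E] {f : α → E} (hf : MemLp f 2 μ) : ∫⁻ x, ‖f x‖ₑ ^ 2 ∂μ ≠ ⊤ := by
  have := eLpNorm_nnreal_pow_eq_lintegral (p := 2) (μ := μ) (f := f) two_ne_zero
  have h2 : eLpNorm f 2 μ ^ 2 = ∫⁻ x, ‖f x‖ₑ ^ 2 ∂μ := by simpa using this
  rw [← h2]
  exact ENNReal.pow_ne_top hf.eLpNorm_ne_top

/-- The smooth functions with compact support. -/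
def testFunctions (n : ℕ) : Submodule ℝ (Rn n → ℝ) where
  carrier := {φ | ContDiff ℝ ∞ φ ∧ HasCompactSupport φ}
  add_mem' ha hb := ⟨ha.1.add hb.1, ha.2.add hb.2⟩
  zero_mem' := ⟨contDiff_const, HasCompactSupport.zero⟩
  smul_mem' c _ ha := ⟨contDiff_const.smul ha.1, ha.2.smul_left (f := fun _ => c)⟩

lemma memLp_gradient_of_mem_testFunctions {n : ℕ} {φ : Rn n → ℝ} (hφ : φ ∈ testFunctions n)
    (Ω : Set (Rn n)) : MemLp (gradient φ) 2 (volume.restrict Ω) := by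
  have hc : Continuous (gradient φ) :=
    (InnerProductSpace.toDual ℝ (Rn n)).symm.continuous.comp
      (hφ.1.continuous_fderiv (by simp))
  have hs : HasCompactSupport (gradient φ) :=
    (hφ.2.fderiv ℝ).comp_left (g := (InnerProductSpace.toDual ℝ (Rn n)).symm) (map_zero _)
  exact (hc.memLp_of_hasCompactSupport hs).restrict Ω

/-- The gradient, as a map into `L²(Ω)ⁿ`. -/
noncomputable def gradientLp {n : ℕ} (Ω : Set (Rn n)) :
    testFunctions n →ₗ[ℝ] Lp (Rn n) 2 (volume.restrict Ω) where
  toFun φ := (memLp_gradient_of_mem_testFunctions φ.2 Ω).toLp _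
  map_add' φ ψ := by
    rw [← MemLp.toLp_add]
    congr 1
    ext1 x
    simp only [gradient, Submodule.coe_add, Pi.add_apply]
    rw [fderiv_add (φ.2.1.differentiable (by simp) x) (ψ.2.1.differentiable (by simp) x), map_add]
  map_smul' c φ := by
    rw [RingHom.id_apply, ← MemLp.toLp_const_smul]
    congr 1
    ext1 x
    simp only [gradient, Submodule.coe_smul, Pi.smul_apply]
    rw [fderiv_const_smul (φ.2.1.differentiable (by simp) x), map_smul]

lemma memLp_of_mem_testFunctions {n : ℕ} {φ : Rn n → ℝ} (hφ : φ ∈ testFunctions n)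
    (Ω : Set (Rn n)) : MemLp φ 2 (volume.restrict Ω) :=
  (hφ.1.continuous.memLp_of_hasCompactSupport hφ.2).restrict Ω

lemma integrable_mul_of_memLp_two {α : Type*} [MeasurableSpace α] {μ : Measure α} {f g : α → ℝ}
    (hf : MemLp f 2 μ) (hg : MemLp g 2 μ) : Integrable (fun x => f x * g x) μ :=
  hf.integrable_mul hg

/-- The functional `φ ↦ -∫ f φ`. -/
noncomputable def negIntegralMul {n : ℕ} {Ω : Set (Rn n)} {f : Rn n → ℝ}
    (hf : MemLp f 2 (volume.restrict Ω)) : testFunctions n →ₗ[ℝ] ℝ where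
  toFun φ := -∫ x in Ω, f x * φ.1 x
  map_add' φ ψ := by
    simp only [Submodule.coe_add, Pi.add_apply, mul_add]
    rw [integral_add (integrable_mul_of_memLp_two hf (memLp_of_mem_testFunctions φ.2 Ω))
      (integrable_mul_of_memLp_two hf (memLp_of_mem_testFunctions ψ.2 Ω)), neg_add]
  map_smul' c φ := by
    simp only [Submodule.coe_smul, Pi.smul_apply, smul_eq_mul, RingHom.id_apply]
    rw [mul_neg, ← integral_const_mul]
    congr 2 with x
    ring

lemma abs_integral_mul_le_norm_mul_norm {α : Type*} [MeasurableSpace α] {μ : Measure α}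
    {f g : α → ℝ} (hf : MemLp f 2 μ) (hg : MemLp g 2 μ) :
    |∫ x, f x * g x ∂μ| ≤ ‖hf.toLp f‖ * ‖hg.toLp g‖ := by
  have : ∫ x, f x * g x ∂μ = inner ℝ (hf.toLp f) (hg.toLp g) := by
    rw [L2.inner_def]
    refine integral_congr_ae ?_
    filter_upwards [hf.coeFn_toLp, hg.coeFn_toLp] with x hx hy
    simp only [hx, hy, RCLike.inner_apply, conj_trivial]
    ring
  rw [this]
  exact abs_real_inner_le_norm _ _

/-- The field represents the functional `φ ↦ -∫ f φ`, which the Poincaré inequality bounds by the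
norm of `∇φ`. The test functions need not vanish on `∂Ω`, so one identity yields both the weak
divergence and the zero normal trace. -/
lemma HasPoincare.exists_hDivField {n : ℕ} {Ω : Set (Rn n)} (hfin : volume Ω ≠ ⊤)
    (hP : HasPoincare Ω Ω) :
    ∃ K : ℝ, 0 ≤ K ∧ ∀ f : Rn n → ℝ, MemLp f 2 (volume.restrict Ω) → ∫ x in Ω, f x = 0 →
      ∃ q : HDivField Ω, q.div = f ∧ q.NormalTraceZero ∧
        ∫ x in Ω, ‖q.toFun x‖ ^ 2 ≤ K * ∫ x in Ω, f x ^ 2 := by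
  obtain ⟨C, hC, hP⟩ := hP
  have : IsFiniteMeasure (volume.restrict Ω) := ⟨by simpa using hfin.lt_top⟩
  refine ⟨C.toReal, ENNReal.toReal_nonneg, fun f hf hf0 => ?_⟩
  have hbound : ∀ φ : testFunctions n, |negIntegralMul hf φ| ≤
      √C.toReal * ‖hf.toLp f‖ * ‖gradientLp Ω φ‖ := by
    intro φ
    obtain ⟨m, hm⟩ := hP φ.1 (φ.2.1.of_le (by simp))
    have hφ := memLp_of_mem_testFunctions φ.2 Ω
    have hφm : MemLp (fun x => φ.1 x - m) 2 (volume.restrict Ω) := hφ.sub (memLp_const m)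
    -- Since `f` has mean zero, the Poincaré constant `m` may be subtracted from `φ`.
    have heq : ∫ x in Ω, f x * φ.1 x = ∫ x in Ω, f x * (φ.1 x - m) := by
      simp only [mul_sub]
      rw [integral_sub (integrable_mul_of_memLp_two hf hφ)
        ((hf.integrable one_le_two).mul_const m), integral_mul_const, hf0]
      simp
    have hgrad := memLp_gradient_of_mem_testFunctions φ.2 Ω
    have hnorm : ‖hφm.toLp _‖ ≤ √C.toReal * ‖gradientLp Ω φ‖ := by
      refine le_of_sq_le_sq ?_ (by positivity)
      rw [mul_pow, Real.sq_sqrt ENNReal.toReal_nonneg]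
      change _ ≤ _ * ‖hgrad.toLp _‖ ^ 2
      rw [norm_toLp_sq_eq_toReal_lintegral, norm_toLp_sq_eq_toReal_lintegral,
        ← ENNReal.toReal_mul]
      refine ENNReal.toReal_mono (ENNReal.mul_ne_top hC (lintegral_enorm_sq_ne_top hgrad)) ?_
      refine hm.trans (le_of_eq ?_)
      congr 2 with x
      rw [gradient, LinearIsometryEquiv.enorm_map]
    calc |negIntegralMul hf φ| = |∫ x in Ω, f x * (φ.1 x - m)| := by
          rw [← heq]; exact abs_neg _
      _ ≤ ‖hf.toLp f‖ * ‖hφm.toLp _‖ := abs_integral_mul_le_norm_mul_norm hf hφm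
      _ ≤ ‖hf.toLp f‖ * (√C.toReal * ‖gradientLp Ω φ‖) := by gcongr
      _ = _ := by ring
  obtain ⟨q, hq, hqφ⟩ := exists_inner_eq_of_abs_le (gradientLp Ω) (negIntegralMul hf)
    (by positivity) hbound
  have hweak : ∀ φ : testFunctions n,
      Integrable (fun x => fderiv ℝ φ.1 x (q x)) (volume.restrict Ω) ∧
        ∫ x in Ω, fderiv ℝ φ.1 x (q x) = -∫ x in Ω, f x * φ.1 x := by
    intro φ
    have hae : (fun x => inner ℝ (q x) (gradientLp Ω φ x)) =ᵐ[volume.restrict Ω]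
        fun x => fderiv ℝ φ.1 x (q x) := by
      filter_upwards [(memLp_gradient_of_mem_testFunctions φ.2 Ω).coeFn_toLp] with x hx
      change inner ℝ (q x) ((memLp_gradient_of_mem_testFunctions φ.2 Ω).toLp _ x) = _
      rw [hx, real_inner_comm, gradient, InnerProductSpace.toDual_symm_apply]
    refine ⟨(L2.integrable_inner q (gradientLp Ω φ)).congr hae, ?_⟩
    rw [← integral_congr_ae hae, ← L2.inner_def, hqφ]
    rfl
  refine ⟨⟨q, f, Lp.memLp q, hf, fun φ hφ hφ' _ => (hweak ⟨φ, hφ, hφ'⟩).2⟩, rfl, ?_, ?_⟩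
  · intro φ hφ hφ'
    have h := hweak ⟨φ, hφ, hφ'⟩
    dsimp only at h ⊢
    rw [integral_add h.1
      (integrable_mul_of_memLp_two hf (memLp_of_mem_testFunctions (φ := φ) ⟨hφ, hφ'⟩ Ω)), h.2,
      neg_add_cancel]
  · have h1 := norm_toLp_sq_eq_integral (Lp.memLp q)
    rw [Lp.toLp_coeFn] at h1
    have h2 := norm_toLp_sq_eq_integral hf
    simp only [Real.norm_eq_abs, sq_abs] at h2
    rw [← h1, ← h2, ← Real.sq_sqrt (ENNReal.toReal_nonneg (a := C)), ← mul_pow]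
    gcongr

/-! ### Flows on the forest -/

namespace RootedForest

variable {V : Type*} (F : RootedForest V)

/-- The component of `v` is a finite tree, nontrivial because its root has a neighbor. It has two
distinct leaves, and at most one of them is the root. -/
lemma exists_terminal_reachable [Finite V] (v : V) :
    ∃ t : F.Terminal, F.graph.Reachable v t.1 := by
  classical
  have := Fintype.ofFinite V
  obtain ⟨ρ, ⟨hρ, hρv⟩, huniq⟩ := F.existsUnique_root v
  set c := F.graph.connectedComponentMk v with hc
  have htree := F.acyclic.isTree_connectedComponent c
  have hmem : ∀ u : V, u ∈ c.supp ↔ F.graph.Reachable v u := fun u => by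
    rw [SimpleGraph.ConnectedComponent.mem_supp_iff, hc, SimpleGraph.ConnectedComponent.eq]
    exact ⟨.symm, .symm⟩
  obtain ⟨w, hw⟩ := Set.ncard_eq_one.1 (F.root_degree ρ hρ)
  have hadj : F.graph.Adj ρ w := by
    have : w ∈ F.graph.neighborSet ρ := by rw [hw]; rfl
    exact this
  have hnt : Nontrivial c.supp := ⟨⟨ρ, (hmem ρ).2 hρv.symm⟩,
    ⟨w, (hmem w).2 (hρv.symm.trans hadj.reachable)⟩, fun h => hadj.ne (congrArg Subtype.val h)⟩
  have hleaf : ∀ u : c.supp, c.toSimpleGraph.degree u = 1 →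
      (F.graph.neighborSet u.1).ncard = 1 := by
    intro u hu
    rw [SimpleGraph.degree_eq_one_iff_existsUnique_adj] at hu
    obtain ⟨x, hx, hxu⟩ := hu
    rw [Set.ncard_eq_one]
    refine ⟨x.1, Set.eq_singleton_iff_unique_mem.2 ⟨hx, fun y hy => ?_⟩⟩
    have hyc : y ∈ c.supp := (hmem y).2 (((hmem u.1).1 u.2).trans hy.reachable)
    exact congrArg Subtype.val (hxu ⟨y, hyc⟩ hy)
  obtain ⟨a, b, hab, ha, hb⟩ := htree.exists_ne_and_degree_eq_one
  by_cases har : a.1 ∈ F.roots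
  · refine ⟨⟨b.1, fun hbr => hab (Subtype.ext ?_), hleaf b hb⟩, (hmem b.1).1 b.2⟩
    rw [huniq a.1 ⟨har, ((hmem a.1).1 a.2).symm⟩, huniq b.1 ⟨hbr, ((hmem b.1).1 b.2).symm⟩]
  · exact ⟨⟨a.1, har, hleaf a ha⟩, (hmem a.1).1 a.2⟩

/-- In a forest, the distances of adjacent nodes from their root differ by exactly one. -/
lemma outward_iff_not_outward_symm {u w : V} (h : F.graph.Adj u w) :
    F.Outward w u ↔ ¬ F.Outward u w := by
  obtain ⟨ρ, ⟨hρ, hρu⟩, huniq⟩ := F.existsUnique_root u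
  have hu : F.Outward u w ↔ F.graph.dist ρ u < F.graph.dist ρ w :=
    ⟨fun ⟨σ, hσ, hσu, hlt⟩ => by rwa [huniq σ ⟨hσ, hσu⟩] at hlt, fun hlt => ⟨ρ, hρ, hρu, hlt⟩⟩
  have hw : F.Outward w u ↔ F.graph.dist ρ w < F.graph.dist ρ u :=
    ⟨fun ⟨σ, hσ, hσw, hlt⟩ => by
      rwa [huniq σ ⟨hσ, hσw.trans h.symm.reachable⟩] at hlt,
      fun hlt => ⟨ρ, hρ, hρu.trans h.reachable, hlt⟩⟩
  have hne := F.acyclic.dist_eq_dist_add_one_of_adj_of_reachable ρ h hρu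
  rw [hu, hw]
  omega

lemma flow_add (p q : F.Edge → ℝ) (i j : V) : F.flow (p + q) i j = F.flow p i j + F.flow q i j := by
  unfold flow
  split_ifs <;> simp [add_comm]

lemma flow_smul (a : ℝ) (q : F.Edge → ℝ) (i j : V) : F.flow (a • q) i j = a * F.flow q i j := by
  unfold flow
  split_ifs <;> simp

/-- The total flow into each node. -/
noncomputable def inflow [Fintype V] : (F.Edge → ℝ) →ₗ[ℝ] V → ℝ where
  toFun q i := ∑ j, F.flow q j i
  map_add' p q := by
    ext i
    simp [flow_add, Finset.sum_add_distrib]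
  map_smul' a q := by
    ext i
    simp [flow_smul, Finset.mul_sum]

open Classical in
-- A unit flux on the single edge, signed by its orientation; along a walk such fluxes telescope.
lemma exists_inflow_eq_of_adj [Fintype V] {u w : V} (h : F.graph.Adj u w) :
    ∃ q, F.inflow q = Pi.single w 1 - Pi.single u 1 := by
  have hne := h.ne
  set q : F.Edge → ℝ := Pi.single ⟨s(u, w), h⟩ (if F.Outward u w then 1 else -1) with hq
  have hzero : ∀ i j, s(i, j) ≠ s(u, w) → F.flow q i j = 0 := by
    intro i j hij
    unfold flow
    split_ifs <;> simp [hq, Subtype.ext_iff, hij]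
  have huw : F.flow q u w = 1 := by
    unfold flow
    rw [dif_pos h, hq, Pi.single_eq_same]
    split_ifs <;> simp
  have hwu : F.flow q w u = -1 := by
    unfold flow
    have hs : (⟨s(w, u), h.symm⟩ : F.Edge) = ⟨s(u, w), h⟩ := Subtype.ext Sym2.eq_swap
    rw [dif_pos h.symm, hs, hq, Pi.single_eq_same, F.outward_iff_not_outward_symm h]
    split_ifs <;> simp_all
  refine ⟨q, ?_⟩
  ext i
  change ∑ j, F.flow q j i = _
  by_cases hiw : i = w
  · subst hiw
    rw [Finset.sum_eq_single u (fun j _ hj => hzero _ _ ?_) (by simp), huw]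
    · simp [hne.symm]
    · intro hs
      rcases Sym2.eq_iff.1 hs with ⟨h1, -⟩ | ⟨-, h2⟩
      exacts [hj h1, hne h2.symm]
  by_cases hiu : i = u
  · subst hiu
    rw [Finset.sum_eq_single w (fun j _ hj => hzero _ _ ?_) (by simp), hwu]
    · simp [hne]
    · intro hs
      rcases Sym2.eq_iff.1 hs with ⟨-, h2⟩ | ⟨h1, -⟩
      exacts [hne h2, hj h1]
  rw [Finset.sum_eq_zero fun j _ => hzero _ _ ?_]
  · simp [hiw, hiu]
  · intro hs
    rcases Sym2.eq_iff.1 hs with ⟨-, h2⟩ | ⟨-, h2⟩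
    exacts [hiw h2, hiu h2]

open Classical in
lemma exists_inflow_eq_of_reachable [Fintype V] {u w : V} (h : F.graph.Reachable u w) :
    ∃ q, F.inflow q = Pi.single w 1 - Pi.single u 1 := by
  obtain ⟨p⟩ := h
  induction p with
  | nil => exact ⟨0, by simp⟩
  | cons hadj _ ih =>
    obtain ⟨q, hq⟩ := ih
    obtain ⟨q', hq'⟩ := F.exists_inflow_eq_of_adj hadj
    exact ⟨q + q', by rw [map_add, hq, hq']; abel⟩

open Classical in
/-- Extension by zero of a function on the terminals. -/
noncomputable def extendTerminal : (F.Terminal → ℝ) →ₗ[ℝ] V → ℝ where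
  toFun a i := if h : F.IsTerminal i then a ⟨i, h⟩ else 0
  map_add' a b := by
    ext i
    by_cases h : F.IsTerminal i <;> simp [h]
  map_smul' s a := by
    ext i
    by_cases h : F.IsTerminal i <;> simp [h]

open Classical in
lemma extendTerminal_single (t : F.Terminal) :
    F.extendTerminal (Pi.single t 1) = Pi.single t.1 1 := by
  ext i
  change (if h : F.IsTerminal i then (Pi.single t 1 : F.Terminal → ℝ) ⟨i, h⟩ else 0) = _
  by_cases h : F.IsTerminal i
  · simp [h, Pi.single_apply, Subtype.ext_iff]
  · have : i ≠ t.1 := fun hit => h (hit ▸ t.2)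
    simp [h, this]

open Classical in
/-- The total transfer, and the node balance of transfers `p.1` and edge fluxes `p.2`. -/
noncomputable def balance [Fintype V] :
    ((F.Terminal → ℝ) × (F.Edge → ℝ)) →ₗ[ℝ] ℝ × (F.Free → ℝ) where
  toFun p := (∑ i, p.1 i, fun i => F.extendTerminal p.1 i.1 - F.inflow p.2 i.1)
  map_add' p q := by
    ext i
    · simp [Finset.sum_add_distrib]
    · simp; ring
  map_smul' s p := by
    ext i
    · simp [Finset.mul_sum]
    · simp; ring

/-- Sending one unit from a node `v` to a terminal and out through its transfer produces total
transfer `1` and balance `1` at `v` only. If `v` is a Dirichlet root, no free node sees it. These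
vectors span the target. -/
lemma balance_surjective [Fintype V] (hD : F.dirichlet.Nonempty) :
    Function.Surjective F.balance := by
  classical
  obtain ⟨ρ, hρ⟩ := hD
  have hroot : ((1 : ℝ), (0 : F.Free → ℝ)) ∈ LinearMap.range F.balance := by
    obtain ⟨t, ht⟩ := F.exists_terminal_reachable ρ
    obtain ⟨q, hq⟩ := F.exists_inflow_eq_of_reachable ht
    refine ⟨(Pi.single t 1, q), Prod.ext ?_ (funext fun i => ?_)⟩
    · simp [balance]
    · have hi : i.1 ≠ ρ := fun h => i.2 (h ▸ hρ)
      simp [balance, hq, extendTerminal_single, hi]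
  have hnode : ∀ v : F.Free,
      ((1 : ℝ), (Pi.single v 1 : F.Free → ℝ)) ∈ LinearMap.range F.balance := by
    intro v
    obtain ⟨t, ht⟩ := F.exists_terminal_reachable v.1
    obtain ⟨q, hq⟩ := F.exists_inflow_eq_of_reachable ht
    refine ⟨(Pi.single t 1, q), Prod.ext ?_ (funext fun i => ?_)⟩
    · simp [balance]
    · simp [balance, hq, extendTerminal_single, Pi.single_apply, Subtype.ext_iff]
  intro y
  change y ∈ LinearMap.range F.balance
  have hy : y = ∑ v, y.2 v • ((1 : ℝ), (Pi.single v 1 : F.Free → ℝ)) +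
      (y.1 - ∑ v, y.2 v) • ((1 : ℝ), (0 : F.Free → ℝ)) := by
    refine Prod.ext ?_ (funext fun i => ?_)
    · simp [Prod.fst_sum]
    · simp [Prod.snd_sum, Pi.single_apply]
  rw [hy]
  exact add_mem (Submodule.sum_mem _ fun v _ => Submodule.smul_mem _ _ (hnode v))
    (Submodule.smul_mem _ _ hroot)

open Classical in
-- A linear right inverse between finite-dimensional spaces is bounded, so `K` depends on the forest
-- alone.
lemma exists_bounded_flow [Fintype V] (hD : F.dirichlet.Nonempty) :
    ∃ K : ℝ, 0 ≤ K ∧ ∀ (s : ℝ) (w : F.Free → ℝ) (R : ℝ), |s| ≤ R → (∀ i, |w i| ≤ R) →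
      ∃ (a : F.Terminal → ℝ) (q : F.Edge → ℝ), ∑ i, a i = s ∧
        (∀ i : F.Free, (if h : F.IsTerminal i.1 then a ⟨i.1, h⟩ else 0) -
          ∑ j, F.flow q j i.1 = w i) ∧
        (∀ i, |a i| ≤ K * R) ∧ ∀ e, |q e| ≤ K * R := by
  obtain ⟨g, hg⟩ := F.balance.exists_rightInverse_of_surjective
    (LinearMap.range_eq_top.2 (F.balance_surjective hD))
  set g' := LinearMap.toContinuousLinearMap g
  refine ⟨‖g'‖, norm_nonneg _, fun s w R hs hw => ?_⟩
  have hR : 0 ≤ R := (abs_nonneg s).trans hs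
  have hsw : ‖(s, w)‖ ≤ R := by
    rw [Prod.norm_def, max_le_iff]
    exact ⟨hs, (pi_norm_le_iff_of_nonneg hR).2 hw⟩
  have hbound : ‖g (s, w)‖ ≤ ‖g'‖ * R :=
    (g'.le_opNorm (s, w)).trans (by gcongr)
  have hbal : F.balance (g (s, w)) = (s, w) := LinearMap.congr_fun hg (s, w)
  refine ⟨(g (s, w)).1, (g (s, w)).2, congrArg Prod.fst hbal,
    fun i => congrFun (congrArg Prod.snd hbal) i, fun i => ?_, fun e => ?_⟩
  · exact (norm_le_pi_norm _ i).trans ((norm_fst_le _).trans hbound)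
  · exact (norm_le_pi_norm _ e).trans ((norm_snd_le _).trans hbound)

end RootedForest

/-! ### The inf-sup condition -/

/-- With `η = A⁻¹ ξ`, coercivity reads `κ |η|² ≤ ξ · η`; inserting it in `0 ≤ |κ η - ξ|²` gives the
upper bound. -/
lemma Matrix.PosDef.inv_dotProduct_bounds {n : ℕ} {A : Matrix (Fin n) (Fin n) ℝ} (hA : A.PosDef)
    {κ : ℝ} (hκ : 0 < κ) (h : ∀ ξ : Fin n → ℝ, κ * (ξ ⬝ᵥ ξ) ≤ ξ ⬝ᵥ (A *ᵥ ξ)) (ξ : Fin n → ℝ) :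
    0 ≤ ξ ⬝ᵥ (A⁻¹ *ᵥ ξ) ∧ ξ ⬝ᵥ (A⁻¹ *ᵥ ξ) ≤ κ⁻¹ * (ξ ⬝ᵥ ξ) := by
  set η := A⁻¹ *ᵥ ξ with hη
  have hunit : IsUnit A.det := (Matrix.isUnit_iff_isUnit_det A).1 hA.isUnit
  have hAη : A *ᵥ η = ξ := by
    rw [hη, Matrix.mulVec_mulVec, Matrix.mul_nonsing_inv _ hunit, Matrix.one_mulVec]
  have h1 := h η
  rw [hAη, dotProduct_comm η ξ] at h1
  have h2 : 0 ≤ η ⬝ᵥ η := dotProduct_self_star_nonneg η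
  have h3 : 0 ≤ (κ • η - ξ) ⬝ᵥ (κ • η - ξ) := dotProduct_self_star_nonneg _
  simp only [sub_dotProduct, dotProduct_sub, smul_dotProduct, dotProduct_smul, smul_eq_mul,
    dotProduct_comm η ξ] at h3
  refine ⟨(mul_nonneg hκ.le h2).trans h1, ?_⟩
  rw [← div_eq_inv_mul, le_div_iff₀ hκ]
  nlinarith [mul_le_mul_of_nonneg_left h1 hκ.le]

namespace MDScalar

variable {n : ℕ} {Ω : Set (Rn n)} {V : Type*} [Fintype V] {F : RootedForest V}

lemma inner_self_nonneg (r : MDScalar Ω F) : 0 ≤ r.inner r :=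
  add_nonneg (integral_nonneg fun _ => mul_self_nonneg _)
    (Finset.sum_nonneg fun _ _ => mul_self_nonneg _)

lemma norm_nonneg (r : MDScalar Ω F) : 0 ≤ r.norm := Real.sqrt_nonneg _

lemma norm_sq (r : MDScalar Ω F) : r.norm ^ 2 = r.inner r := Real.sq_sqrt r.inner_self_nonneg

lemma integral_sq_le_norm_sq (r : MDScalar Ω F) : ∫ x in Ω, r.D x ^ 2 ≤ r.norm ^ 2 := by
  classical
  rw [norm_sq]
  unfold inner
  simp only [sq]
  exact le_add_of_nonneg_right (Finset.sum_nonneg fun i _ => mul_self_nonneg (r.N i))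

lemma abs_node_le_norm (r : MDScalar Ω F) (i : F.Free) : |r.N i| ≤ r.norm := by
  classical
  refine abs_le_of_sq_le_sq ?_ r.norm_nonneg
  rw [norm_sq, sq]
  unfold inner
  refine le_add_of_nonneg_of_le (integral_nonneg fun _ => mul_self_nonneg _) ?_
  exact Finset.single_le_sum (f := fun i => r.N i * r.N i) (fun _ _ => mul_self_nonneg _)
    (Finset.mem_univ i)

lemma abs_integral_le (r : MDScalar Ω F) (hr : r.MemL2) (hfin : volume Ω ≠ ⊤) :
    |∫ x in Ω, r.D x| ≤ √(volume.real Ω) * r.norm := by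
  have : IsFiniteMeasure (volume.restrict Ω) := ⟨by simpa using hfin.lt_top⟩
  have h1 : MemLp (fun _ : Rn n => (1 : ℝ)) 2 (volume.restrict Ω) := memLp_const 1
  have hrD : MemLp r.D 2 (volume.restrict Ω) := hr
  have h := abs_integral_mul_le_norm_mul_norm h1 hrD
  simp only [one_mul] at h
  refine h.trans (mul_le_mul ?_ ?_ (_root_.norm_nonneg _) (Real.sqrt_nonneg _))
  · refine Real.le_sqrt_of_sq_le ?_
    rw [norm_toLp_sq_eq_integral]
    simp
  · refine le_of_sq_le_sq ?_ r.norm_nonneg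
    rw [norm_toLp_sq_eq_integral]
    simpa using r.integral_sq_le_norm_sq

lemma inner_eq_zero_of_norm_eq_zero (r w : MDScalar Ω F) (hr : r.MemL2) (h : r.norm = 0) :
    r.inner w = 0 := by
  classical
  have hN : ∀ i, r.N i = 0 := fun i => abs_nonpos_iff.1 (h ▸ r.abs_node_le_norm i)
  have hfsq : ∫ x in Ω, r.D x ^ 2 = 0 :=
    le_antisymm (by simpa [h] using r.integral_sq_le_norm_sq)
      (integral_nonneg fun _ => sq_nonneg _)
  rw [integral_eq_zero_iff_of_nonneg (fun _ => sq_nonneg _) hr.integrable_sq] at hfsq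
  unfold inner
  rw [integral_eq_zero_of_ae, Finset.sum_eq_zero fun i _ => by rw [hN, zero_mul], add_zero]
  filter_upwards [hfsq] with x hx
  simp only [Pi.zero_apply, sq_eq_zero_iff] at hx
  simp [hx]

end MDScalar

lemma integral_add_sq_le {α : Type*} [MeasurableSpace α] {μ : Measure α} [IsFiniteMeasure μ]
    {f g : α → ℝ} (hf : MemLp f 2 μ) {G : ℝ} (hg : ∀ᵐ x ∂μ, |g x| ≤ G) :
    ∫ x, (f x + g x) ^ 2 ∂μ ≤ 2 * ∫ x, f x ^ 2 ∂μ + 2 * (μ.real Set.univ * G ^ 2) := by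
  have hfsq : Integrable (fun x => 2 * f x ^ 2) μ := hf.integrable_sq.const_mul 2
  calc ∫ x, (f x + g x) ^ 2 ∂μ ≤ ∫ x, (2 * f x ^ 2 + 2 * G ^ 2) ∂μ := by
        refine integral_mono_of_nonneg (Filter.Eventually.of_forall fun _ => sq_nonneg _)
          (hfsq.add (integrable_const _)) ?_
        filter_upwards [hg] with x hx
        have : g x ^ 2 ≤ G ^ 2 := sq_le_sq' (by linarith [(abs_le.1 hx).1]) (abs_le.1 hx).2
        nlinarith [sq_nonneg (f x - g x)]
    _ = _ := by
        rw [integral_add hfsq (integrable_const _), integral_const_mul, integral_const, smul_eq_mul]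
        ring

namespace CoupledModel

variable {n : ℕ} {Ω : Set (Rn n)} {V : Type*} {F : RootedForest V} (M : CoupledModel Ω F)

lemma kS_nonneg (i : F.Terminal) (x : Rn n) : 0 ≤ M.kS i x := Real.sqrt_nonneg _

lemma measurable_kS (i : F.Terminal) : Measurable (M.kS i) := (M.measurable_kT i).sqrt

lemma kS_eq_zero {i : F.Terminal} {x : Rn n} (hx : x ∉ M.B i) : M.kS i x = 0 := by
  have : M.kT i x = 0 := by
    by_contra h
    exact hx (M.kT_support i h)
  rw [kS, this, Real.sqrt_zero]

lemma setIntegral_kS (hΩ : MeasurableSet Ω) (i : F.Terminal) :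
    ∫ x in Ω, M.kS i x = ∫ x in M.B i, M.kS i x :=
  setIntegral_eq_of_subset_of_forall_sdiff_eq_zero hΩ (M.B_subset i)
    fun _ hx => M.kS_eq_zero hx.2

end CoupledModel

open Classical in
/-- The mixed-dimensional divergence has a right inverse, bounded uniformly in the coefficients. -/
lemma exists_flux_mixedDiv_eq {n : ℕ} {Ω : Set (Rn n)} (hΩ : IsBoundedLipschitzDomain Ω)
    {V : Type*} [Fintype V] (F : RootedForest V) (hD : F.dirichlet.Nonempty)
    (c C κD κN : ℝ) (hc : 0 < c) (hκD : 0 < κD) (hκN : 0 < κN) :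
    ∃ Q : ℝ, 0 ≤ Q ∧ ∀ M : CoupledModel Ω F,
      (∀ i, c ≤ ∫ x in M.B i, M.kS i x) →
      (∀ i, ∀ x ∈ Ω, M.kS i x ≤ C) →
      (∀ x ∈ Ω, ∀ ξ : Fin n → ℝ, κD * (ξ ⬝ᵥ ξ) ≤ ξ ⬝ᵥ (M.kD x *ᵥ ξ)) →
      (∀ e, κN ≤ M.kN e) →
      ∀ r : MDScalar Ω F, r.MemL2 → ∃ q : M.Flux, q.MemH0 ∧ q.mixedDiv = r ∧
        0 ≤ q.weightedNormSq ∧ q.weightedNormSq ≤ Q * r.norm ^ 2 := by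
  have hfin : volume Ω ≠ ⊤ := hΩ.isBounded.measure_lt_top.ne
  have hΩm := hΩ.isOpen.measurableSet
  have : IsFiniteMeasure (volume.restrict Ω) := ⟨by simpa using hfin.lt_top⟩
  obtain ⟨K₁, hK₁, hdiv⟩ := hΩ.hasPoincare.exists_hDivField hfin
  obtain ⟨K₂, hK₂, hflow⟩ := F.exists_bounded_flow hD
  set v : ℝ := volume.real Ω with hv
  have hv0 : 0 ≤ v := measureReal_nonneg
  set k : ℝ := K₂ * (1 + √v) with hk
  have hk0 : 0 ≤ k := by positivity
  set T : ℝ := (Fintype.card F.Terminal : ℝ) with hT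
  -- The three summands bound the domain, transfer and edge parts. Relative to `r.norm`, `k` bounds
  -- the `a i` and the edge fluxes, `k / c` the transfer fluxes, and `T * (|C| * (k / c))` the
  -- transfer term `g`.
  refine ⟨κD⁻¹ * (K₁ * (2 + 2 * (v * (T * (|C| * (k / c))) ^ 2))) + T * (v * (k / c) ^ 2)
    + (Fintype.card F.Edge : ℝ) * (κN⁻¹ * k ^ 2), by positivity, ?_⟩
  intro M hcM hCM hDM hNM r hr
  set R := r.norm with hR
  have hR0 : 0 ≤ R := r.norm_nonneg
  -- The factor `1 + √v` covers both data: `√v` for the mean of `r.D` by Cauchy–Schwarz, `1` for the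
  -- node values.
  obtain ⟨a, qN, hasum, hbal, ha, hqN⟩ := hflow (-∫ x in Ω, r.D x) r.N ((1 + √v) * R)
    (by
      rw [abs_neg]
      have := r.abs_integral_le hr hfin
      nlinarith)
    (fun i => by
      have := r.abs_node_le_norm i
      nlinarith [Real.sqrt_nonneg v, mul_nonneg (Real.sqrt_nonneg v) hR0])
  rw [← mul_assoc, ← hk] at ha hqN
  set m : F.Terminal → ℝ := fun i => ∫ x in M.B i, M.kS i x with hm
  have hm0 : ∀ i, 0 < m i := fun i => hc.trans_le (hcM i)
  have ham : ∀ i, |a i / m i| ≤ k / c * R := fun i => by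
    rw [abs_div, abs_of_pos (hm0 i), div_mul_eq_mul_div]
    exact div_le_div₀ (by positivity) (ha i) hc (hcM i)
  set g : Rn n → ℝ := fun x => ∑ i, M.kS i x * (a i / m i) with hg
  have hgm : Measurable g := Finset.measurable_sum _ fun i _ => (M.measurable_kS i).mul_const _
  have hkSC : ∀ i, ∀ x ∈ Ω, |M.kS i x| ≤ |C| := fun i x hx => by
    rw [abs_of_nonneg (M.kS_nonneg i x)]
    exact (hCM i x hx).trans (le_abs_self C)
  have hgb : ∀ x ∈ Ω, |g x| ≤ T * (|C| * (k / c)) * R := by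
    intro x hx
    calc |g x| ≤ ∑ i, |M.kS i x * (a i / m i)| := Finset.abs_sum_le_sum_abs _ _
      _ ≤ ∑ _i : F.Terminal, |C| * (k / c * R) := by
          gcongr with i
          rw [abs_mul]
          exact mul_le_mul (hkSC i x hx) (ham i) (abs_nonneg _) (abs_nonneg _)
      _ = _ := by
          rw [Finset.sum_const, Finset.card_univ, nsmul_eq_mul]
          ring
  have hgae : ∀ᵐ x ∂volume.restrict Ω, |g x| ≤ T * (|C| * (k / c)) * R :=
    (ae_restrict_iff' hΩm).2 (Filter.Eventually.of_forall hgb)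
  have hgL : MemLp g 2 (volume.restrict Ω) := MemLp.of_bound hgm.aestronglyMeasurable _ hgae
  have hkSint : ∀ i, Integrable (M.kS i) (volume.restrict Ω) := fun i =>
    Integrable.of_bound (M.measurable_kS i).aestronglyMeasurable |C|
      ((ae_restrict_iff' hΩm).2 (Filter.Eventually.of_forall (hkSC i)))
  have hgint : ∫ x in Ω, g x = -∫ x in Ω, r.D x := by
    rw [← hasum, hg, integral_finsetSum _ fun i _ => (hkSint i).mul_const _]
    refine Finset.sum_congr rfl fun i _ => ?_
    rw [integral_mul_const, M.setIntegral_kS hΩm]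
    exact mul_div_cancel₀ _ (hm0 i).ne'
  -- The total transfer was chosen so that `r.D + g` has mean zero.
  obtain ⟨qD, hqdiv, hq0, hqn⟩ := hdiv (fun x => r.D x + g x) (hr.add hgL) (by
    rw [integral_add (hr.integrable one_le_two) (hgL.integrable one_le_two), hgint,
      add_neg_cancel])
  have hBfin : ∀ i, IsFiniteMeasure (volume.restrict (M.B i)) := fun i =>
    ⟨by simpa using (measure_mono (M.B_subset i)).trans_lt hfin.lt_top⟩
  refine ⟨⟨qD, fun i _ => a i / m i, fun i => memLp_const _, qN⟩, hq0, ?_, ?_, ?_⟩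
  · have hN : ∀ i : F.Free, (if h : F.IsTerminal i.1 then
        (∫ x in M.B ⟨i.1, h⟩, M.kS ⟨i.1, h⟩ x * (a ⟨i.1, h⟩ / m ⟨i.1, h⟩)) else 0)
        - ∑ j, F.flow qN j i.1 = r.N i := by
      intro i
      rw [← hbal i]
      congr 1
      split_ifs with h
      · rw [integral_mul_const]
        exact mul_div_cancel₀ _ (hm0 _).ne'
      · rfl
    cases r with
    | mk rD rN =>
      unfold CoupledModel.Flux.mixedDiv
      congr 1
      · ext x
        simp only [hqdiv]
        exact add_sub_cancel_right _ _
      · exact funext hN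
  · refine add_nonneg (add_nonneg ?_ ?_) ?_
    · exact setIntegral_nonneg hΩm fun x hx =>
        ((M.kD_posDef x hx).inv_dotProduct_bounds hκD (hDM x hx) _).1
    · exact Finset.sum_nonneg fun i _ => integral_nonneg fun _ => sq_nonneg _
    · exact Finset.sum_nonneg fun e _ =>
        mul_nonneg (inv_nonneg.2 (M.kN_pos e).le) (sq_nonneg _)
  · rw [add_mul, add_mul]
    refine add_le_add (add_le_add ?_ ?_) ?_
    · calc ∫ x in Ω, (qD.toFun x).ofLp ⬝ᵥ ((M.kD x)⁻¹ *ᵥ (qD.toFun x).ofLp)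
          ≤ ∫ x in Ω, κD⁻¹ * ‖qD.toFun x‖ ^ 2 := by
            have hb : ∀ x ∈ Ω, _ := fun x hx =>
              (M.kD_posDef x hx).inv_dotProduct_bounds hκD (hDM x hx) (qD.toFun x).ofLp
            refine integral_mono_of_nonneg
              ((ae_restrict_iff' hΩm).2 (Filter.Eventually.of_forall fun x hx => (hb x hx).1))
              (qD.memLp.integrable_norm_pow two_ne_zero |>.const_mul _)
              ((ae_restrict_iff' hΩm).2 (Filter.Eventually.of_forall fun x hx => ?_))
            refine (hb x hx).2.trans (le_of_eq ?_)
            change _ = κD⁻¹ * ‖qD.toFun x‖ ^ 2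
            rw [EuclideanSpace.real_norm_sq_eq]
            exact congrArg (κD⁻¹ * ·) (Finset.sum_congr rfl fun i _ => (sq _).symm)
        _ = κD⁻¹ * ∫ x in Ω, ‖qD.toFun x‖ ^ 2 := integral_const_mul _ _
        _ ≤ κD⁻¹ * (K₁ * (2 * R ^ 2 + 2 * (v * (T * (|C| * (k / c)) * R) ^ 2))) := by
            refine mul_le_mul_of_nonneg_left (hqn.trans ?_) (inv_nonneg.2 hκD.le)
            refine mul_le_mul_of_nonneg_left ((integral_add_sq_le hr hgae).trans ?_) hK₁
            rw [measureReal_restrict_apply_univ]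
            gcongr
            exact r.integral_sq_le_norm_sq
        _ = _ := by ring
    · calc ∑ i, ∫ _ in M.B i, (a i / m i) ^ 2 ≤ ∑ _i : F.Terminal, v * (k / c * R) ^ 2 := by
            gcongr with i
            rw [integral_const, smul_eq_mul, measureReal_restrict_apply_univ]
            refine mul_le_mul (measureReal_mono (M.B_subset i) hfin) ?_ (sq_nonneg _) hv0
            exact sq_le_sq' (by linarith [(abs_le.1 (ham i)).1]) (abs_le.1 (ham i)).2
        _ = _ := by
            rw [Finset.sum_const, Finset.card_univ, nsmul_eq_mul]
            ring
    · calc ∑ e, (M.kN e)⁻¹ * qN e ^ 2 ≤ ∑ _e : F.Edge, κN⁻¹ * (k * R) ^ 2 := by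
            refine Finset.sum_le_sum fun e _ => mul_le_mul (inv_anti₀ hκN (hNM e)) ?_
              (sq_nonneg _) (inv_nonneg.2 hκN.le)
            exact sq_le_sq' (by linarith [(abs_le.1 (hqN e)).1]) (abs_le.1 (hqN e)).2
        _ = _ := by
            rw [Finset.sum_const, Finset.card_univ, nsmul_eq_mul]
            ring

/-- Fluxes consist of functions rather than classes, so those of zero norm are excluded. With the
supremum in `EReal`, the quotients need not be shown bounded above. -/
theorem lemma2p4 {n : ℕ} (hn : 0 < n) (Ω : Set (Rn n)) (hΩ : IsBoundedLipschitzDomain Ω)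
    {V : Type*} [Fintype V] (F : RootedForest V) (hD : F.dirichlet.Nonempty)
    (b : ℝ) (overlap : ℕ) (c C κD κN : ℝ) (hc : 0 < c) (hκD : 0 < κD) (hκN : 0 < κN) :
    ∃ β : ℝ, 0 < β ∧ ∀ M : CoupledModel Ω F,
      (∀ i, volume.real (M.B i) ≤ b) →
      (∀ x, {i | x ∈ M.B i}.ncard ≤ overlap) →
      (∀ i, c ≤ ∫ x in M.B i, M.kS i x) →
      (∀ i, ∀ x ∈ Ω, M.kS i x ≤ C) →
      (∀ x ∈ Ω, ∀ ξ : Fin n → ℝ, κD * (ξ ⬝ᵥ ξ) ≤ ξ ⬝ᵥ (M.kD x *ᵥ ξ)) →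
      (∀ e, κN ≤ M.kN e) →
      ∀ r : MDScalar Ω F, r.MemL2 →
        ((β * r.norm : ℝ) : EReal) ≤
          ⨆ (q : M.Flux) (_ : q.MemH0) (_ : q.norm ≠ 0),
            ((r.inner q.mixedDiv / q.norm : ℝ) : EReal) := by
  obtain ⟨Q, hQ, hflux⟩ := exists_flux_mixedDiv_eq hΩ F hD c C κD κN hc hκD hκN
  refine ⟨(√(Q + 1))⁻¹, by positivity, ?_⟩
  intro M _ _ hcM hCM hDM hNM r hr
  have key : ∀ w : MDScalar Ω F, w.MemL2 → w.norm ≠ 0 → ∃ q : M.Flux, q.MemH0 ∧ q.mixedDiv = w ∧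
      0 < q.norm ∧ q.norm ≤ √(Q + 1) * w.norm := by
    intro w hw hw0
    obtain ⟨q, hq0, hqw, hqn, hqQ⟩ := hflux M hcM hCM hDM hNM w hw
    have hwpos : 0 < w.norm := w.norm_nonneg.lt_of_ne' hw0
    refine ⟨q, hq0, hqw, Real.sqrt_pos.2 (by rw [hqw]; positivity), ?_⟩
    refine Real.sqrt_le_iff.2 ⟨by positivity, ?_⟩
    rw [mul_pow, Real.sq_sqrt (by positivity), hqw]
    linarith
  by_cases hr0 : r.norm = 0
  -- The supremum of an empty family would be `⊥`, so even for `r.norm = 0` some flux of nonzero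
  -- norm is needed; one with divergence `[1, 0]` serves.
  · have hvol : 0 < volume.real Ω :=
      ENNReal.toReal_pos (hΩ.isOpen.measure_pos volume hΩ.isConnected.nonempty).ne'
        hΩ.isBounded.measure_lt_top.ne
    have : IsFiniteMeasure (volume.restrict Ω) := ⟨by simpa using hΩ.isBounded.measure_lt_top⟩
    obtain ⟨q, hq0, -, hq, -⟩ := key ⟨fun _ => 1, 0⟩ (memLp_const 1)
      (Real.sqrt_ne_zero'.2 (by simpa [MDScalar.inner] using hvol))
    refine le_iSup_of_le q (le_iSup_of_le hq0 (le_iSup_of_le hq.ne' ?_))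
    rw [hr0, r.inner_eq_zero_of_norm_eq_zero _ hr hr0]
    simp
  · obtain ⟨q, hq0, hqr, hq, hqn⟩ := key r hr hr0
    refine le_iSup_of_le q (le_iSup_of_le hq0 (le_iSup_of_le hq.ne' ?_))
    rw [EReal.coe_le_coe_iff, hqr, ← r.norm_sq, le_div_iff₀ hq]
    calc (√(Q + 1))⁻¹ * r.norm * q.norm ≤ (√(Q + 1))⁻¹ * r.norm * (√(Q + 1) * r.norm) :=
          mul_le_mul_of_nonneg_left hqn (mul_nonneg (by positivity) r.norm_nonneg)
      _ = r.norm ^ 2 := by field_simp
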